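/- Work in the universe $V$ of set theory with the axiom of choice. Let $N$ and $M$ be transitive inner models of ZFC (transitive classes containing all ordinals and satisfying ZFC), and let $j:N\to M$ be an elementary embedding for the language $\{\in\}$ with critical point $\kappa$, that is, $\kappa$ is the least ordinal with $j(\kappa)\neq\kappa$. Let $\lambda\geq\kappa$ be a cardinal (it may be a cardinal of $V$ or of $N$; the statement holds for any ordinal $\lambda\ge\kappa$), and let $\lambda^+$ be the least cardinal of $V$ greater than $\lambda$. Suppose that $j$ is continuous at every ordinal $\delta\geq\lambda^+$ that is a regular cardinal in $N$, i.e. $j(\delta)=\sup\{j(\alpha)\mid\alpha<\delta\}$ for all such $\delta$. If $A\in M$ satisfies $|A|^M\leq j(\lambda)$ (there is in $M$ an injection from $A$ into $j(\lambda)$), then $|A\cap\operatorname{ran}(j)|^V\leq|\lambda|^V$ (which is $\lambda$ when $\lambda$ is a cardinal of $V$), where $\operatorname{ran}(j)=\{j(x)\mid x\in N\}$. -/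

import Mathlib

open FirstOrder

universe u

/-- The relation symbols of the language of set theory: one binary symbol. -/
inductive MemSymb : ℕ → Type
  | mem : MemSymb 2

/-- The first-order language of set theory. -/
def setLang : Language := ⟨fun _ => Empty, MemSymb⟩

/-- The interpretation of the membership symbol in a structure for the language of set theory. -/
def SetMem {X : Type*} [setLang.Structure X] (x y : X) : Prop :=
  Language.Structure.RelMap (L := setLang) MemSymb.mem ![x, y]

infix:50 " ∈ₘ " => SetMem

/-- `X` satisfies the axioms of ZFC.  Each single axiom is unfolded according to the definition of
truth in `X`; the two schemes range over all first-order formulas, whose parameters are given by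
the assignment `v`. -/
structure ModelsZFC (X : Type*) [setLang.Structure X] : Prop where
  extensionality : ∀ x y : X, (∀ z, z ∈ₘ x ↔ z ∈ₘ y) → x = y
  foundation : ∀ x : X, (∃ y, y ∈ₘ x) → ∃ y, y ∈ₘ x ∧ ∀ z, z ∈ₘ x → ¬ z ∈ₘ y
  pairing : ∀ x y : X, ∃ p, ∀ z, z ∈ₘ p ↔ z = x ∨ z = y
  union : ∀ x : X, ∃ s, ∀ z, z ∈ₘ s ↔ ∃ y, y ∈ₘ x ∧ z ∈ₘ y
  powerset : ∀ x : X, ∃ p, ∀ y, y ∈ₘ p ↔ ∀ z, z ∈ₘ y → z ∈ₘ x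
  infinity : ∃ x : X, (∃ e, e ∈ₘ x ∧ ∀ z, ¬ z ∈ₘ e) ∧
    ∀ y, y ∈ₘ x → ∃ s, s ∈ₘ x ∧ ∀ z, z ∈ₘ s ↔ z ∈ₘ y ∨ z = y
  separation : ∀ (φ : setLang.BoundedFormula ℕ 1) (v : ℕ → X) (x : X),
    ∃ y, ∀ z, z ∈ₘ y ↔ z ∈ₘ x ∧ φ.Realize v ![z]
  replacement : ∀ (φ : setLang.BoundedFormula ℕ 2) (v : ℕ → X) (x : X),
    (∀ a, a ∈ₘ x → ∃! b, φ.Realize v ![a, b]) →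
      ∃ y, ∀ b, b ∈ₘ y ↔ ∃ a, a ∈ₘ x ∧ φ.Realize v ![a, b]
  choice : ∀ x : X, (∀ y, y ∈ₘ x → ∃ z, z ∈ₘ y) →
    (∀ y y', y ∈ₘ x → y' ∈ₘ x → y ≠ y' → ¬ ∃ z, z ∈ₘ y ∧ z ∈ₘ y') →
      ∃ c, ∀ y, y ∈ₘ x → ∃! z, z ∈ₘ y ∧ z ∈ₘ c

/-- A class of sets is a structure for the language of set theory, with the true membership. -/
instance classStructure (C : Set ZFSet.{u}) : setLang.Structure C where
  funMap f := nomatch f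
  RelMap r := match r with
    | MemSymb.mem => fun v => (v 0 : ZFSet.{u}) ∈ (v 1 : ZFSet.{u})

/-- A transitive inner model of ZFC in the universe `V = ZFSet`: a transitive class that contains
all the ordinals and satisfies ZFC. -/
structure InnerModel where
  carrier : Set ZFSet.{u}
  transitive : ∀ x ∈ carrier, ∀ y ∈ x, y ∈ carrier
  ordinals : ∀ α : Ordinal.{u}, α.toZFSet ∈ carrier
  zfc : ModelsZFC carrier

namespace InnerModel

instance : CoeSort InnerModel.{u} (Type (u + 1)) := ⟨fun N => N.carrier⟩

/-- The (von Neumann) ordinal `α` as an element of the inner model `N`. -/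
noncomputable def ord (N : InnerModel.{u}) (α : Ordinal.{u}) : N :=
  ⟨α.toZFSet, N.ordinals α⟩

/-- `|A|^M ≤ |B|^M`: some element of `M` is an injective function from `A` to `B`. -/
def CardLE (M : InnerModel.{u}) (A B : M) : Prop :=
  ∃ f : M, ZFSet.IsFunc (A : ZFSet.{u}) (B : ZFSet.{u}) (f : ZFSet.{u}) ∧
    ∀ x y z : ZFSet.{u}, ZFSet.pair x z ∈ (f : ZFSet.{u}) → ZFSet.pair y z ∈ (f : ZFSet.{u}) → x = y

/-- `δ` is a regular cardinal in the sense of `N`: it is infinite, and every function in `N` from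
an ordinal `α < δ` to `δ` is bounded in `δ`. -/
def IsRegular (N : InnerModel.{u}) (δ : Ordinal.{u}) : Prop :=
  Ordinal.omega0 ≤ δ ∧
    ∀ α < δ, ∀ f : N, ZFSet.IsFunc α.toZFSet δ.toZFSet (f : ZFSet.{u}) →
      ∃ β < δ, ∀ x y : ZFSet.{u}, ZFSet.pair x y ∈ (f : ZFSet.{u}) → y ∈ β.toZFSet

variable {N M : InnerModel.{u}}

/-- `κ` is the critical point of `j`: the least ordinal moved by `j`. -/
def IsCriticalPoint (j : N ↪ₑ[setLang] M) (κ : Ordinal.{u}) : Prop :=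
  j (N.ord κ) ≠ M.ord κ ∧ ∀ α < κ, j (N.ord α) = M.ord α

/-- `j` is continuous at `δ`: `j(δ) = sup {j(α) | α < δ}`, the supremum of a set of (von Neumann)
ordinals being its union. -/
def IsContinuousAt (j : N ↪ₑ[setLang] M) (δ : Ordinal.{u}) : Prop :=
  (j (N.ord δ) : ZFSet.{u}) = ZFSet.iUnion fun α : Set.Iio δ => (j (N.ord α) : ZFSet.{u})

/-- The range of `j`, as a class of sets. -/
def ran (j : N ↪ₑ[setLang] M) : Set ZFSet.{u} :=
  Set.range fun x : N => (j x : ZFSet.{u})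

end InnerModel

/-! Counting `A ∩ ran j` reduces to counting ordinals. Preimages of its elements lie in one set `B`
of `N`. Let `e` in `N` enumerate `B` by an ordinal `α`, and let `f` in `M` inject `A` into `j(λ)`.
Then `r = j(e⁻¹) ∘ f⁻¹` is a partial function in `M` on `j(λ)`, and the index `β` of every preimage
satisfies `j(β) ∈ r''j(λ)`.

So it suffices that `{x < δ | j(x) ∈ r''j(λ)}` has size at most `|λ|` for every `δ` and every such
`r` (`mk_valueOrds_le`), by induction on `δ`. Below `λ⁺` this is trivial. If `δ` is regular in `N`,
then `j(δ)` is regular in `M`, so the values of `r` below `j(δ)` are bounded, and continuity gives a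
bound `j(α)` with `α < δ` (`valueOrds_subset_of_isRegular`). Otherwise a cofinal map from some `α <
δ` splits the set into pieces below `δ`, indexed by a set of the same kind for `α` and another
function. The critical point serves to make `λ` infinite. -/

/-! ### Formulas with de Bruijn indices and their translation to first-order formulas. -/

/-- Formulas of set theory, with de Bruijn indices for the variables. -/
inductive SetFml : Type
  | mem (i j : ℕ)
  | eq (i j : ℕ)
  | neg (φ : SetFml)
  | and (φ ψ : SetFml)
  | or (φ ψ : SetFml)
  | iff (φ ψ : SetFml)
  | imp (φ ψ : SetFml)
  | all (φ : SetFml)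
  | ex (φ : SetFml)

/-- The assignment `v` with `x` put in front. -/
def scons {X : Type*} (x : X) (v : ℕ → X) : ℕ → X
  | 0 => x
  | n + 1 => v n

infixr:67 " ;; " => scons

section scons

variable {X : Type*} (x : X) (v : ℕ → X)

@[simp] theorem scons_zero : (x ;; v) 0 = x := rfl
@[simp] theorem scons_succ (n : ℕ) : (x ;; v) (n + 1) = v n := rfl

theorem comp_scons {Y : Type*} (f : X → Y) : f ∘ (x ;; v) = f x ;; (f ∘ v) := by
  funext n; cases n <;> rfl

end scons

namespace SetFml

/-- Truth in a structure under an assignment. -/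
@[simp] def sat {X : Type*} [setLang.Structure X] : SetFml → (ℕ → X) → Prop
  | mem i j, v => v i ∈ₘ v j
  | eq i j, v => v i = v j
  | neg φ, v => ¬ φ.sat v
  | and φ ψ, v => φ.sat v ∧ ψ.sat v
  | or φ ψ, v => φ.sat v ∨ ψ.sat v
  | iff φ ψ, v => φ.sat v ↔ ψ.sat v
  | imp φ ψ, v => φ.sat v → ψ.sat v
  | all φ, v => ∀ x, φ.sat (x ;; v)
  | ex φ, v => ∃ x, φ.sat (x ;; v)

/-- The variable `0` becomes bound, the others move down. -/
def bindZero : ℕ → ℕ ⊕ Fin 1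
  | 0 => Sum.inr 0
  | n + 1 => Sum.inl n

/-- The variables `0` and `1` become the bound variables `1` and `0`, the others move down. -/
def bindTwo : ℕ → ℕ ⊕ Fin 2
  | 0 => Sum.inr 1
  | 1 => Sum.inr 0
  | n + 2 => Sum.inl n

/-- The formula as a Mathlib formula. -/
def toFormula : SetFml → setLang.Formula ℕ
  | mem i j => Language.Relations.formula (L := setLang) (n := 2) MemSymb.mem
      ![Language.Term.var i, Language.Term.var j]
  | eq i j => (Language.Term.var i).equal (Language.Term.var j)
  | neg φ => ∼φ.toFormula
  | and φ ψ => φ.toFormula ⊓ ψ.toFormula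
  | or φ ψ => φ.toFormula ⊔ ψ.toFormula
  | iff φ ψ => Language.BoundedFormula.iff φ.toFormula ψ.toFormula
  | imp φ ψ => Language.BoundedFormula.imp φ.toFormula ψ.toFormula
  | all φ => Language.BoundedFormula.all
      (n := 0) (Language.BoundedFormula.relabel (n := 1) (k := 0) bindZero φ.toFormula)
  | ex φ => Language.BoundedFormula.ex
      (n := 0) (Language.BoundedFormula.relabel (n := 1) (k := 0) bindZero φ.toFormula)

theorem realize_bindZero {X : Type*} [setLang.Structure X] (φ : setLang.Formula ℕ) (v : ℕ → X)
    (xs : Fin 1 → X) :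
    (Language.BoundedFormula.relabel (n := 1) (k := 0) bindZero φ).Realize v xs ↔
      φ.Realize (xs 0 ;; v) := by
  refine Language.BoundedFormula.realize_relabel.trans ?_
  rw [Language.Formula.Realize]
  have h1 : (Sum.elim v (xs ∘ Fin.castAdd 0) ∘ bindZero) = xs 0 ;; v := by
    funext n; cases n <;> rfl
  rw [h1]
  exact iff_of_eq (congrArg _ (Subsingleton.elim _ _))

/-- The swap reconciles `![a, b]` in the replacement axiom, argument first, with assignments that
put the newest variable in front. -/
theorem realize_bindTwo {X : Type*} [setLang.Structure X] (φ : setLang.Formula ℕ) (v : ℕ → X)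
    (xs : Fin 2 → X) :
    (Language.BoundedFormula.relabel (n := 2) (k := 0) bindTwo φ).Realize v xs ↔
      φ.Realize (xs 1 ;; xs 0 ;; v) := by
  refine Language.BoundedFormula.realize_relabel.trans ?_
  rw [Language.Formula.Realize]
  have h1 : (Sum.elim v (xs ∘ Fin.castAdd 0) ∘ bindTwo) = xs 1 ;; xs 0 ;; v := by
    funext n; match n with
    | 0 => rfl
    | 1 => rfl
    | n + 2 => rfl
  rw [h1]
  exact iff_of_eq (congrArg _ (Subsingleton.elim _ _))

theorem realize_toFormula {X : Type*} [setLang.Structure X] (φ : SetFml) (v : ℕ → X) :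
    φ.toFormula.Realize v ↔ φ.sat v := by
  induction φ generalizing v with
  | mem i j =>
    refine Language.Formula.realize_rel.trans (iff_of_eq (congrArg _ ?_))
    funext k
    match k with
    | 0 => rfl
    | 1 => rfl
  | eq i j => simp [toFormula, sat]
  | neg φ ih => simp [toFormula, ih]
  | and φ ψ ih1 ih2 => simp [toFormula, ih1, ih2]
  | or φ ψ ih1 ih2 => simp [toFormula, ih1, ih2]
  | iff φ ψ ih1 ih2 =>
    rw [toFormula, sat, ← ih1, ← ih2]
    exact Language.BoundedFormula.realize_iff
  | imp φ ψ ih1 ih2 =>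
    rw [toFormula, sat, ← ih1, ← ih2]
    exact Language.BoundedFormula.realize_imp
  | all φ ih =>
    rw [toFormula, sat, Language.Formula.Realize, Language.BoundedFormula.realize_all]
    refine forall_congr' fun x => ?_
    rw [← ih]
    exact realize_bindZero _ _ _
  | ex φ ih =>
    rw [toFormula, sat, Language.Formula.Realize, Language.BoundedFormula.realize_ex]
    refine exists_congr fun x => ?_
    rw [← ih]
    exact realize_bindZero _ _ _

/-- The renaming induced under a quantifier. -/
def lift (ρ : ℕ → ℕ) : ℕ → ℕ
  | 0 => 0
  | n + 1 => ρ n + 1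

/-- Renaming of variables. -/
def rename : (ℕ → ℕ) → SetFml → SetFml
  | ρ, mem i j => mem (ρ i) (ρ j)
  | ρ, eq i j => eq (ρ i) (ρ j)
  | ρ, neg φ => neg (φ.rename ρ)
  | ρ, and φ ψ => and (φ.rename ρ) (ψ.rename ρ)
  | ρ, or φ ψ => or (φ.rename ρ) (ψ.rename ρ)
  | ρ, iff φ ψ => iff (φ.rename ρ) (ψ.rename ρ)
  | ρ, imp φ ψ => imp (φ.rename ρ) (ψ.rename ρ)
  | ρ, all φ => all (φ.rename (lift ρ))
  | ρ, ex φ => ex (φ.rename (lift ρ))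

theorem scons_comp_lift {X : Type*} (x : X) (v : ℕ → X) (ρ : ℕ → ℕ) :
    (x ;; v) ∘ lift ρ = x ;; (v ∘ ρ) := by
  funext n; cases n <;> rfl

@[simp] theorem sat_rename {X : Type*} [setLang.Structure X] (φ : SetFml) (ρ : ℕ → ℕ)
    (v : ℕ → X) : (φ.rename ρ).sat v ↔ φ.sat (v ∘ ρ) := by
  induction φ generalizing ρ v with
  | mem i j => rfl
  | eq i j => rfl
  | neg φ ih => simp [rename, ih]
  | and φ ψ ih1 ih2 => simp [rename, ih1, ih2]
  | or φ ψ ih1 ih2 => simp [rename, ih1, ih2]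
  | iff φ ψ ih1 ih2 => simp [rename, ih1, ih2]
  | imp φ ψ ih1 ih2 => simp [rename, ih1, ih2]
  | all φ ih => simp [rename, ih, scons_comp_lift]
  | ex φ ih => simp [rename, ih, scons_comp_lift]

/-- An elementary embedding preserves truth. -/
theorem sat_map {X Y : Type*} [setLang.Structure X] [setLang.Structure Y] (j : X ↪ₑ[setLang] Y)
    (φ : SetFml) (v : ℕ → X) : φ.sat (j ∘ v) ↔ φ.sat v := by
  rw [← realize_toFormula, ← realize_toFormula, j.map_formula]

/-- `v i` is the ordered pair of `v j` and `v k`. -/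
def pair (i j k : ℕ) : SetFml :=
  all (iff (mem 0 (i + 1)) (or (all (iff (mem 0 1) (eq 0 (j + 2))))
    (all (iff (mem 0 1) (or (eq 0 (j + 2)) (eq 0 (k + 2)))))))

/-- The pair of `v i` and `v j` belongs to `v k`. -/
def app (i j k : ℕ) : SetFml := ex (and (pair 0 (i + 1) (j + 1)) (mem 0 (k + 1)))

/-- `v i` is a subset of `v j`. -/
def sub (i j : ℕ) : SetFml := all (imp (mem 0 (i + 1)) (mem 0 (j + 1)))

end SetFml

/-! ### Separation and replacement. -/

namespace ModelsZFC

variable {X : Type*} [setLang.Structure X] (h : ModelsZFC X)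
include h

theorem sep (φ : SetFml) (v : ℕ → X) (x : X) :
    ∃ y, ∀ z, z ∈ₘ y ↔ z ∈ₘ x ∧ φ.sat (z ;; v) := by
  obtain ⟨y, hy⟩ := h.separation
    (Language.BoundedFormula.relabel (n := 1) (k := 0) SetFml.bindZero φ.toFormula) v x
  refine ⟨y, fun z => (hy z).trans (and_congr_right fun _ => ?_)⟩
  exact (SetFml.realize_bindZero _ _ _).trans (SetFml.realize_toFormula _ _)

/-- Replacement for partial functions. -/
theorem repl (φ : SetFml) (v : ℕ → X) (x : X)
    (hφ : ∀ a, a ∈ₘ x → ∀ b b', φ.sat (b ;; a ;; v) → φ.sat (b' ;; a ;; v) → b = b') :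
    ∃ y, ∀ b, b ∈ₘ y ↔ ∃ a, a ∈ₘ x ∧ φ.sat (b ;; a ;; v) := by
  -- The axiom needs a total function, so `x` is cut down to the domain of `φ`.
  obtain ⟨d, hd⟩ := h.sep (.ex φ) v x
  simp only [SetFml.sat] at hd
  obtain ⟨y, hy⟩ := h.replacement
    (Language.BoundedFormula.relabel (n := 2) (k := 0) SetFml.bindTwo φ.toFormula) v d (by
      intro a ha
      obtain ⟨hax, b, hb⟩ := (hd a).1 ha
      refine ⟨b, (SetFml.realize_bindTwo _ _ _).trans (SetFml.realize_toFormula _ _) |>.2 hb, ?_⟩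
      intro b' hb'
      exact hφ a hax _ _
        ((SetFml.realize_bindTwo _ _ _).trans (SetFml.realize_toFormula _ _) |>.1 hb') hb)
  refine ⟨y, fun b => (hy b).trans (exists_congr fun a => ?_)⟩
  have e := (SetFml.realize_bindTwo φ.toFormula v ![a, b]).trans (SetFml.realize_toFormula _ _)
  rw [e]
  constructor
  · rintro ⟨h1, h2⟩
    exact ⟨((hd a).1 h1).1, h2⟩
  · rintro ⟨h1, h2⟩
    exact ⟨(hd a).2 ⟨h1, b, h2⟩, h2⟩

end ModelsZFC

/-! ### Absoluteness of pairs, subsets and ordinals. -/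

namespace InnerModel

variable (N : InnerModel.{u})

theorem mem_iff {N : InnerModel.{u}} {x y : N} : x ∈ₘ y ↔ (x : ZFSet.{u}) ∈ (y : ZFSet.{u}) :=
  Iff.rfl

theorem ext {N : InnerModel.{u}} {x y : N} (h : ∀ z : N, z ∈ₘ x ↔ z ∈ₘ y) : x = y :=
  N.zfc.extensionality x y h

/-- The element of `N` given by a member of an element of `N`. -/
def sub {N : InnerModel.{u}} (x : N) {y : ZFSet.{u}} (hy : y ∈ (x : ZFSet.{u})) : N :=
  ⟨y, N.transitive _ x.2 _ hy⟩

theorem pair_mem (x y : N) : ({(x : ZFSet.{u}), (y : ZFSet.{u})} : ZFSet.{u}) ∈ N.carrier := by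
  obtain ⟨p, hp⟩ := N.zfc.pairing x y
  convert p.2 using 1
  ext z
  rw [ZFSet.mem_pair]
  constructor
  · rintro (rfl | rfl)
    · exact (hp x).2 (Or.inl rfl)
    · exact (hp y).2 (Or.inr rfl)
  · intro hz
    have := (hp (sub p hz)).1 hz
    rcases this with h | h
    · exact Or.inl (congrArg Subtype.val h)
    · exact Or.inr (congrArg Subtype.val h)

/-- The ordered pair, as an element of the inner model. -/
def pr {N : InnerModel.{u}} (x y : N) : N :=
  ⟨ZFSet.pair x y, by
    have h1 := N.pair_mem x x
    have h2 := N.pair_mem x y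
    have h3 := N.pair_mem ⟨_, h1⟩ ⟨_, h2⟩
    rw [ZFSet.pair]
    simpa using h3⟩

@[simp] theorem coe_pr {N : InnerModel.{u}} (x y : N) :
    ((pr x y : N) : ZFSet.{u}) = ZFSet.pair x y := rfl

@[simp] theorem pr_inj {N : InnerModel.{u}} {x y x' y' : N} :
    pr x y = pr x' y' ↔ x = x' ∧ y = y' := by
  rw [Subtype.ext_iff, coe_pr, coe_pr, ZFSet.pair_inj, Subtype.ext_iff, Subtype.ext_iff]

/-- By transitivity, quantifiers over `N` suffice to test equality with a set of `V` whose members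
lie in `N`. -/
theorem eq_coe_iff {N : InnerModel.{u}} (x : N) (P : ZFSet.{u}) (hP : ∀ y ∈ P, y ∈ N.carrier) :
    (x : ZFSet.{u}) = P ↔ ∀ z : N, z ∈ₘ x ↔ (z : ZFSet.{u}) ∈ P := by
  constructor
  · rintro h z
    rw [mem_iff, h]
  · intro h
    ext z
    constructor
    · intro hz
      exact (h (sub x hz)).1 hz
    · intro hz
      exact (h ⟨z, hP z hz⟩).2 hz

@[simp] theorem sat_pair {N : InnerModel.{u}} (i j k : ℕ) (v : ℕ → N) :
    (SetFml.pair i j k).sat v ↔ v i = pr (v j) (v k) := by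
  rw [Subtype.ext_iff, eq_coe_iff _ _ fun y hy => N.transitive _ (pr (v j) (v k)).2 _ hy]
  simp only [SetFml.pair, SetFml.sat, scons_zero, scons_succ]
  refine forall_congr' fun z => iff_congr Iff.rfl ?_
  rw [coe_pr, ZFSet.pair, ZFSet.mem_pair]
  refine or_congr ?_ ?_
  · rw [eq_coe_iff _ _ (by intro y hy; rw [ZFSet.mem_singleton] at hy; exact hy ▸ (v j).2)]
    simp [Subtype.ext_iff]
  · rw [eq_coe_iff _ _ (N.transitive _ (N.pair_mem (v j) (v k)))]
    simp [Subtype.ext_iff]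

@[simp] theorem sat_app {N : InnerModel.{u}} (i j k : ℕ) (v : ℕ → N) :
    (SetFml.app i j k).sat v ↔ pr (v i) (v j) ∈ₘ v k := by
  simp [SetFml.app]

@[simp] theorem sat_sub {N : InnerModel.{u}} (i j : ℕ) (v : ℕ → N) :
    (SetFml.sub i j).sat v ↔ (v i : ZFSet.{u}) ⊆ v j := by
  simp only [SetFml.sub, SetFml.sat, scons_zero, scons_succ]
  exact ⟨fun h z hz => h (sub _ hz) hz, fun h z hz => h hz⟩

theorem mem_ord {N : InnerModel.{u}} {α : Ordinal.{u}} {x : N} :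
    x ∈ₘ N.ord α ↔ ∃ β < α, x = N.ord β := by
  rw [mem_iff]
  simp only [ord, Ordinal.mem_toZFSet_iff, Subtype.ext_iff, eq_comm]

@[simp] theorem ord_mem_ord {N : InnerModel.{u}} {α β : Ordinal.{u}} : N.ord α ∈ₘ N.ord β ↔ α < β :=
  Ordinal.toZFSet_mem_toZFSet_iff

theorem ord_injective : Function.Injective N.ord := fun _ _ h =>
  Ordinal.toZFSet_injective (congrArg Subtype.val h)

@[simp] theorem ord_inj {α β : Ordinal.{u}} : N.ord α = N.ord β ↔ α = β := N.ord_injective.eq_iff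

end InnerModel

/-! ### Recursion, ranks, choice and enumerations inside an inner model. -/

namespace InnerModel

variable {N : InnerModel.{u}}

theorem exists_powerset (x : N) : ∃ p : N, ∀ y : N, y ∈ₘ p ↔ (y : ZFSet.{u}) ⊆ x := by
  obtain ⟨p, hp⟩ := N.zfc.powerset x
  exact ⟨p, fun y => (hp y).trans
    ⟨fun h z hz => h (sub y hz) hz, fun h z hz => h hz⟩⟩

/-- `s` is the sequence of length `α` recursively given by the class function `φ`, with
variables `0` for `s` and `1` for `α`. -/
def recFml (φ : SetFml) : SetFml :=
  .all (.iff (.mem 0 1) (.ex (.ex (.and (.mem 1 4) (.and (.pair 2 1 0) (.ex (.and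
    (.all (.iff (.mem 0 1) (.and (.mem 0 5) (.ex (.ex (.and (.mem 1 5) (.pair 2 1 0)))))))
    -- The variables are now, innermost first, `t, y, b, p, s, a`, then `v`, with `t` the
    -- restriction of `s` to `b`; `φ` expects `y, t, v`.
    (φ.rename fun n => match n with
      | 0 => 1
      | 1 => 0
      | n + 2 => n + 6))))))))

theorem sat_recFml (φ : SetFml) (v : ℕ → N) (s a : N) :
    (recFml φ).sat (s ;; a ;; v) ↔ ∀ p : N, p ∈ₘ s ↔ ∃ b y : N, b ∈ₘ a ∧ p = pr b y ∧
      ∃ t : N, (∀ q : N, q ∈ₘ t ↔ q ∈ₘ s ∧ ∃ c z : N, c ∈ₘ b ∧ q = pr c z) ∧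
        φ.sat (y ;; t ;; v) := by
  simp only [recFml, SetFml.sat, scons_zero, scons_succ, sat_pair, SetFml.sat_rename]
  refine forall_congr' fun p => iff_congr Iff.rfl <| exists_congr fun b => exists_congr fun y =>
    and_congr_right fun _ => and_congr_right fun _ => exists_congr fun t =>
    and_congr_right fun _ => iff_of_eq (congrArg _ ?_)
  funext n
  match n with
  | 0 => rfl
  | 1 => rfl
  | n + 2 => rfl

/-- Transfinite recursion in an inner model. -/
theorem exists_recursion (φ : SetFml) (v : ℕ → N)
    (hφ : ∀ s : N, ∃! y : N, φ.sat (y ;; s ;; v)) :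
    ∃ F : Ordinal.{u} → N, ∀ α, ∃ s : N,
      (∀ p, p ∈ₘ s ↔ ∃ β < α, p = pr (N.ord β) (F β)) ∧ φ.sat (F α ;; s ;; v) := by
  classical
  choose G hG hGu using hφ
  -- `F` is built by recursion in `V`. The default outside `N` is harmless, as the segments of `F`
  -- turn out to be in `N`.
  let G' : ZFSet.{u} → N := fun z => if hz : z ∈ N.carrier then G ⟨z, hz⟩ else N.ord 0
  let F : Ordinal.{u} → N := WellFounded.fix (C := fun _ => N) (wellFounded_lt (α := Ordinal.{u}))
    fun α f => G' (ZFSet.range fun β : Set.Iio α => ((pr (N.ord β) (f β β.2) : N) : ZFSet.{u}))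
  let S : Ordinal.{u} → ZFSet.{u} := fun α =>
    ZFSet.range fun β : Set.Iio α => ((pr (N.ord β) (F β) : N) : ZFSet.{u})
  have hF : ∀ α, F α = G' (S α) := fun α => WellFounded.fix_eq _ _ α
  have memS : ∀ α (p : N), (p : ZFSet.{u}) ∈ S α ↔ ∃ β < α, p = pr (N.ord β) (F β) := by
    intro α p
    simp only [S, ZFSet.mem_range, Subtype.exists, Set.mem_Iio, Subtype.ext_iff, exists_prop]
    exact exists_congr fun β => and_congr_right fun _ => eq_comm
  have memS' : ∀ α, ∀ p ∈ S α, p ∈ N.carrier := by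
    intro α p hp
    obtain ⟨β, rfl⟩ := ZFSet.mem_range.1 hp
    exact Subtype.prop _
  have eqS : ∀ α (s : N), (∀ p : N, p ∈ₘ s ↔ ∃ β < α, p = pr (N.ord β) (F β)) →
      (s : ZFSet.{u}) = S α := fun α s hs =>
    (eq_coe_iff s _ (memS' α)).2 fun p => (hs p).trans (memS α p).symm
  have hFs : ∀ α (s : N), (∀ p : N, p ∈ₘ s ↔ ∃ β < α, p = pr (N.ord β) (F β)) → F α = G s := by
    intro α s hs
    have e := eqS α s hs
    rw [hF, ← e]
    simp [G']
  -- As far as the segments of `F` are known to be in `N`, `recFml φ` defines them there.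
  have good : ∀ α, (∀ β ≤ α, ∃ t : N, ∀ p : N, p ∈ₘ t ↔ ∃ γ < β, p = pr (N.ord γ) (F γ)) →
      ∀ s : N, (recFml φ).sat (s ;; N.ord α ;; v) ↔
        ∀ p : N, p ∈ₘ s ↔ ∃ β < α, p = pr (N.ord β) (F β) := by
    intro α ht s
    rw [sat_recFml]
    constructor
    · intro h
      have key : ∀ β < α, ∀ y : N, pr (N.ord β) y ∈ₘ s ↔ y = F β := by
        intro β
        induction β using WellFoundedLT.induction with
        | _ β ih =>
          intro hβ y
          have res : ∀ t : N, (∀ q : N, q ∈ₘ t ↔ q ∈ₘ s ∧ ∃ c z : N, c ∈ₘ N.ord β ∧ q = pr c z) ↔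
              ∀ p : N, p ∈ₘ t ↔ ∃ γ < β, p = pr (N.ord γ) (F γ) := by
            intro t
            refine forall_congr' fun q => iff_congr Iff.rfl ?_
            constructor
            · rintro ⟨hq, c, z, hc, rfl⟩
              obtain ⟨γ, hγ, rfl⟩ := mem_ord.1 hc
              exact ⟨γ, hγ, by rw [(ih γ hγ (hγ.trans hβ) z).1 hq]⟩
            · rintro ⟨γ, hγ, rfl⟩
              exact ⟨(ih γ hγ (hγ.trans hβ) _).2 rfl, _, _, ord_mem_ord.2 hγ, rfl⟩
          rw [h]
          constructor
          · rintro ⟨b, y', -, e, t, ht1, ht2⟩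
            obtain ⟨rfl, rfl⟩ := pr_inj.1 e
            rw [hFs β t ((res t).1 ht1)]
            exact hGu _ _ ht2
          · rintro rfl
            obtain ⟨t, ht⟩ := ht β hβ.le
            exact ⟨_, _, ord_mem_ord.2 hβ, rfl, t, (res t).2 ht, hFs β t ht ▸ hG t⟩
      intro p
      constructor
      · intro hp
        obtain ⟨b, y, hb, rfl, -⟩ := (h p).1 hp
        obtain ⟨β, hβ, rfl⟩ := mem_ord.1 hb
        exact ⟨β, hβ, by rw [(key β hβ y).1 hp]⟩
      · rintro ⟨β, hβ, rfl⟩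
        exact (key β hβ _).2 rfl
    · intro h p
      have res : ∀ β < α, ∀ t : N,
          (∀ q : N, q ∈ₘ t ↔ q ∈ₘ s ∧ ∃ c z : N, c ∈ₘ N.ord β ∧ q = pr c z) ↔
            ∀ p : N, p ∈ₘ t ↔ ∃ γ < β, p = pr (N.ord γ) (F γ) := by
        intro β hβ t
        refine forall_congr' fun q => iff_congr Iff.rfl ?_
        constructor
        · rintro ⟨hq, c, z, hc, rfl⟩
          obtain ⟨γ, hγ, rfl⟩ := mem_ord.1 hc
          obtain ⟨γ', -, e⟩ := (h _).1 hq
          obtain ⟨e1, rfl⟩ := pr_inj.1 e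
          rw [ord_inj] at e1
          subst e1
          exact ⟨γ, hγ, rfl⟩
        · rintro ⟨γ, hγ, rfl⟩
          exact ⟨(h _).2 ⟨γ, hγ.trans hβ, rfl⟩, _, _, ord_mem_ord.2 hγ, rfl⟩
      rw [h]
      constructor
      · rintro ⟨β, hβ, rfl⟩
        obtain ⟨t, ht⟩ := ht β hβ.le
        exact ⟨_, _, ord_mem_ord.2 hβ, rfl, t, (res β hβ t).2 ht, hFs β t ht ▸ hG t⟩
      · rintro ⟨b, y, hb, rfl, t, ht1, ht2⟩
        obtain ⟨β, hβ, rfl⟩ := mem_ord.1 hb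
        refine ⟨β, hβ, ?_⟩
        rw [hFs β t ((res β hβ t).1 ht1), hGu _ _ ht2]
  have main : ∀ α, ∃ s : N, ∀ p : N, p ∈ₘ s ↔ ∃ β < α, p = pr (N.ord β) (F β) := by
    intro α
    induction α using WellFoundedLT.induction with
    | _ α ih =>
      have good' : ∀ β < α, ∀ p : N, (∃ y s : N, p = pr (N.ord β) y ∧
          (recFml φ).sat (s ;; N.ord β ;; v) ∧ φ.sat (y ;; s ;; v)) ↔ p = pr (N.ord β) (F β) := by
        intro β hβ p
        have g := good β fun γ hγ => ih γ (hγ.trans_lt hβ)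
        constructor
        · rintro ⟨y, s, rfl, h1, h2⟩
          rw [hFs β s ((g s).1 h1), hGu _ _ h2]
        · rintro rfl
          obtain ⟨s, hs⟩ := ih β hβ
          exact ⟨F β, s, rfl, (g s).2 hs, hFs β s hs ▸ hG s⟩
      -- By induction `ψ` defines `β ↦ (β, F β)` below `α`, so replacement in `N` collects the
      -- segment.
      let ψ : SetFml := .ex (.ex (.and (.pair 2 3 1) (.and
        ((recFml φ).rename fun n => match n with
          | 0 => 0
          | 1 => 3
          | n + 2 => n + 4)
        (φ.rename fun n => match n with
          | 0 => 1
          | 1 => 0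
          | n + 2 => n + 4))))
      have hψ : ∀ p a : N, ψ.sat (p ;; a ;; v) ↔ ∃ y s : N, p = pr a y ∧
          (recFml φ).sat (s ;; a ;; v) ∧ φ.sat (y ;; s ;; v) := by
        intro p a
        simp only [ψ, SetFml.sat, scons_zero, scons_succ,
          sat_pair, SetFml.sat_rename]
        refine exists_congr fun y => exists_congr fun s => and_congr_right fun _ => and_congr ?_ ?_
        all_goals
          refine iff_of_eq (congrArg _ ?_)
          funext n
          match n with
          | 0 => rfl
          | 1 => rfl
          | n + 2 => rfl
      obtain ⟨s, hs⟩ := N.zfc.repl ψ v (N.ord α) (by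
        intro a ha p p' h1 h2
        obtain ⟨β, hβ, rfl⟩ := mem_ord.1 ha
        rw [hψ, good' β hβ] at h1 h2
        rw [h1, h2])
      refine ⟨s, fun p => (hs p).trans ?_⟩
      simp only [hψ]
      constructor
      · rintro ⟨a, ha, h⟩
        obtain ⟨β, hβ, rfl⟩ := mem_ord.1 ha
        exact ⟨β, hβ, (good' β hβ p).1 h⟩
      · rintro ⟨β, hβ, h⟩
        exact ⟨_, ord_mem_ord.2 hβ, (good' β hβ p).2 h⟩
  refine ⟨F, fun α => ?_⟩
  obtain ⟨s, hs⟩ := main α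
  exact ⟨s, hs, hFs α s hs ▸ hG s⟩

/-- The levels of the cumulative hierarchy of `N` belong to `N`. -/
theorem exists_rank_lt (ρ : Ordinal.{u}) :
    ∃ B : N, ∀ x : N, x ∈ₘ B ↔ (x : ZFSet.{u}).rank < ρ := by
  -- The uniform recursion `V_ρ = ⋃_{β<ρ} P(V_β)` avoids a case split on `ρ`.
  let φ : SetFml := .all (.iff (.mem 0 1) (.ex (.ex (.and (.app 1 0 4) (.sub 2 0)))))
  have hφ : ∀ (v : ℕ → N) (s y : N), φ.sat (y ;; s ;; v) ↔
      ∀ x : N, x ∈ₘ y ↔ ∃ b w : N, pr b w ∈ₘ s ∧ (x : ZFSet.{u}) ⊆ w := by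
    intro v s y
    simp [φ]
  obtain ⟨F, hF⟩ := exists_recursion φ (fun _ => N.ord 0) (by
    intro s
    simp only [hφ]
    -- If `(b, w) ∈ s` then `w ∈ ⋃⋃s`, so every subset of `w` lies in `P(⋃⋃⋃s)`.
    obtain ⟨u₁, h₁⟩ := N.zfc.union s
    obtain ⟨u₂, h₂⟩ := N.zfc.union u₁
    obtain ⟨u₃, h₃⟩ := N.zfc.union u₂
    obtain ⟨P, hP⟩ := exists_powerset u₃
    obtain ⟨y, hy⟩ := N.zfc.sep (.ex (.ex (.and (.app 1 0 3) (.sub 2 0)))) (fun _ => s) P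
    simp only [SetFml.sat, sat_app, sat_sub, scons_zero, scons_succ] at hy
    have hy₁ : ∀ x : N, x ∈ₘ y ↔ ∃ b w : N, pr b w ∈ₘ s ∧ (x : ZFSet.{u}) ⊆ w := by
      refine fun x => (hy x).trans (and_iff_right_of_imp ?_)
      rintro ⟨b, w, hbw, hx⟩
      rw [hP]
      intro z hz
      let q : N := ⟨{(b : ZFSet.{u}), (w : ZFSet.{u})}, N.pair_mem b w⟩
      refine (h₃ (sub x hz)).2 ⟨w, (h₂ w).2 ⟨q, (h₁ q).2 ⟨pr b w, hbw, ?_⟩, ?_⟩, hx hz⟩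
      · rw [mem_iff, coe_pr, ZFSet.pair, ZFSet.mem_pair]
        exact Or.inr rfl
      · exact ZFSet.mem_pair.2 (Or.inr rfl)
    exact ⟨y, hy₁, fun y' hy' => ext fun x => (hy' x).trans (hy₁ x).symm⟩)
  refine ⟨F ρ, ?_⟩
  induction ρ using WellFoundedLT.induction with
  | _ ρ ih =>
    intro x
    obtain ⟨s, hs, h⟩ := hF ρ
    rw [(hφ _ _ _).1 h x]
    constructor
    · rintro ⟨b, w, hbw, hx⟩
      obtain ⟨β, hβ, e⟩ := (hs _).1 hbw
      obtain ⟨rfl, rfl⟩ := pr_inj.1 e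
      refine lt_of_le_of_lt (ZFSet.rank_le_iff.2 fun z hz => ?_) hβ
      exact (ih β hβ (sub x hz)).1 (hx hz)
    · intro hx
      refine ⟨_, _, (hs _).2 ⟨_, hx, rfl⟩, fun z hz => ?_⟩
      exact (ih _ hx (sub x hz)).2 (ZFSet.rank_lt_of_mem hz)

/-- A choice function for the nonempty subsets of `B`. -/
theorem exists_choice (B : N) : ∃ c : N, ∀ X : N, (X : ZFSet.{u}) ⊆ B → (∃ z : N, z ∈ₘ X) →
    ∃! z : N, z ∈ₘ X ∧ pr X z ∈ₘ c := by
  obtain ⟨P, hP⟩ := exists_powerset B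
  -- The axiom of choice asks for a disjoint family, so `X` is replaced by `{X} × X`.
  let φ : SetFml := .and (.ex (.mem 0 2))
    (.all (.iff (.mem 0 1) (.ex (.and (.mem 0 3) (.pair 1 3 0)))))
  have hφ : ∀ (v : ℕ → N) (y X : N), φ.sat (y ;; X ;; v) ↔
      (∃ z : N, z ∈ₘ X) ∧ ∀ p : N, p ∈ₘ y ↔ ∃ b : N, b ∈ₘ X ∧ p = pr X b := by
    intro v y X
    simp [φ]
  obtain ⟨T, hT⟩ := N.zfc.repl φ (fun _ => B) P (by
    intro X _ y y' h h'
    rw [hφ] at h h'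
    exact ext fun p => (h.2 p).trans (h'.2 p).symm)
  simp only [hφ] at hT
  obtain ⟨c, hc⟩ := N.zfc.choice T (by
    intro y hy
    obtain ⟨X, -, ⟨z, hz⟩, h⟩ := (hT y).1 hy
    exact ⟨_, (h _).2 ⟨z, hz, rfl⟩⟩) (by
    rintro y y' hy hy' hne ⟨p, hp, hp'⟩
    obtain ⟨X, -, -, h⟩ := (hT y).1 hy
    obtain ⟨X', -, -, h'⟩ := (hT y').1 hy'
    obtain ⟨b, -, rfl⟩ := (h p).1 hp
    obtain ⟨b', -, e⟩ := (h' _).1 hp'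
    obtain ⟨rfl, -⟩ := pr_inj.1 e
    exact hne (ext fun q => (h q).trans (h' q).symm))
  refine ⟨c, fun X hX hne => ?_⟩
  obtain ⟨y, hy⟩ := N.zfc.repl (.pair 0 2 1) (fun _ => X) X (by
    intro a _ b b' h h'
    rw [sat_pair] at h h'
    exact h.trans h'.symm)
  simp only [sat_pair, scons_zero, scons_succ] at hy
  obtain ⟨p, ⟨hp, hpc⟩, hu⟩ := hc y ((hT y).2 ⟨X, (hP X).2 hX, hne, hy⟩)
  obtain ⟨z, hz, rfl⟩ := (hy p).1 hp
  refine ⟨z, ⟨hz, hpc⟩, fun z' ⟨hz', hc'⟩ => ?_⟩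
  exact (pr_inj.1 (hu _ ⟨(hy _).2 ⟨z', hz', rfl⟩, hc'⟩)).2

/-- In an inner model of ZFC, every set is enumerated without repetitions by an ordinal. -/
theorem exists_enumeration (B : N) : ∃ (α : Ordinal.{u}) (F : Ordinal.{u} → N) (e : N),
    (∀ p, p ∈ₘ e ↔ ∃ β < α, p = pr (N.ord β) (F β)) ∧
    (∀ β < α, ∀ γ < α, F β = F γ → β = γ) ∧ ∀ z, z ∈ₘ B → ∃ β < α, z = F β := by
  obtain ⟨c, hc⟩ := exists_choice B
  -- The next value is the chosen element of `X`, the part of `B` not yet listed; the default `B`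
  -- makes the recursion total.
  let φ : SetFml := .all (.imp
    (.all (.iff (.mem 0 1) (.and (.mem 0 4) (.neg (.ex (.app 0 1 4))))))
    (.or (.and (.mem 1 0) (.app 0 1 4)) (.and (.neg (.ex (.mem 0 1))) (.eq 1 3))))
  have hφ : ∀ s y : N, φ.sat (y ;; s ;; B ;; fun _ => c) ↔ ∀ X : N,
      (∀ z : N, z ∈ₘ X ↔ z ∈ₘ B ∧ ¬ ∃ b, pr b z ∈ₘ s) →
      (y ∈ₘ X ∧ pr X y ∈ₘ c) ∨ ((¬ ∃ z, z ∈ₘ X) ∧ y = B) := by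
    intro s y
    simp [φ]
  have hX : ∀ s : N, ∃ X : N, ∀ z : N, z ∈ₘ X ↔ z ∈ₘ B ∧ ¬ ∃ b, pr b z ∈ₘ s := by
    intro s
    obtain ⟨X, hX⟩ := N.zfc.sep (.neg (.ex (.app 0 1 2))) (fun _ => s) B
    exact ⟨X, by simpa using hX⟩
  obtain ⟨F, hF⟩ := exists_recursion φ (B ;; fun _ => c) (by
    intro s
    simp only [hφ]
    obtain ⟨X, hX⟩ := hX s
    have hX' : ∀ X' : N, (∀ z : N, z ∈ₘ X' ↔ z ∈ₘ B ∧ ¬ ∃ b, pr b z ∈ₘ s) → X' = X :=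
      fun X' h => ext fun z => (h z).trans (hX z).symm
    by_cases hne : ∃ z, z ∈ₘ X
    · obtain ⟨z, hz, hu⟩ := hc X (fun z hz => ((hX (sub X hz)).1 hz).1) hne
      refine ⟨z, fun X' h => ?_, fun z' h => ?_⟩
      · rw [hX' X' h]
        exact Or.inl hz
      · rcases h X hX with h | h
        · exact hu _ h
        · exact absurd hne h.1
    · refine ⟨B, fun X' h => ?_, fun z' h => ?_⟩
      · rw [hX' X' h]
        exact Or.inr ⟨hne, rfl⟩
      · rcases h X hX with h | h
        · exact absurd ⟨_, h.1⟩ hne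
        · exact h.2)
  have step : ∀ α, (∃ z, z ∈ₘ B ∧ ∀ β < α, z ≠ F β) → F α ∈ₘ B ∧ ∀ β < α, F α ≠ F β := by
    rintro α ⟨z, hz, hne⟩
    obtain ⟨s, hs, h⟩ := hF α
    obtain ⟨X, hX⟩ := hX s
    have hX' : ∀ z, z ∈ₘ X ↔ z ∈ₘ B ∧ ∀ β < α, z ≠ F β := by
      intro z
      rw [hX]
      refine and_congr_right fun _ => ?_
      constructor
      · rintro h β hβ rfl
        exact h ⟨_, (hs _).2 ⟨β, hβ, rfl⟩⟩
      · rintro h ⟨b, hb⟩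
        obtain ⟨β, hβ, e⟩ := (hs _).1 hb
        exact h β hβ (pr_inj.1 e).2
    rcases (hφ _ _).1 h X hX with h | h
    · exact (hX' _).1 h.1
    · exact absurd ⟨z, (hX' z).2 ⟨hz, hne⟩⟩ h.1
  have ex : ∃ α, ∀ z, z ∈ₘ B → ∃ β < α, z = F β := by
    -- Otherwise `F` would inject all ordinals into the set `B`.
    by_contra! hcon
    have h : ∀ α, F α ∈ₘ B ∧ ∀ β < α, F α ≠ F β := fun α => step α (hcon α)
    refine not_injective_of_ordinal
      (fun α => (⟨F α, (h α).1⟩ : (B : ZFSet.{u}))) fun α β e => ?_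
    have e' : F α = F β := Subtype.ext (Subtype.mk.inj e)
    rcases lt_trichotomy α β with hlt | heq | hlt
    · exact absurd e'.symm ((h β).2 α hlt)
    · exact heq
    · exact absurd e' ((h α).2 β hlt)
  -- Before the least such `α` something is always left to list, so values do not repeat.
  let α := sInf {α | ∀ z, z ∈ₘ B → ∃ β < α, z = F β}
  have hα : ∀ z, z ∈ₘ B → ∃ β < α, z = F β := csInf_mem ex
  have hinj : ∀ β < α, ∀ γ < β, F β ≠ F γ := by
    intro β hβ
    have := notMem_of_lt_csInf' hβ
    rw [Set.mem_ofPred_eq] at this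
    push Not at this
    exact (step β this).2
  obtain ⟨e, he, -⟩ := hF α
  refine ⟨α, F, e, he, fun β hβ γ hγ e => ?_, hα⟩
  rcases lt_trichotomy β γ with hlt | heq | hlt
  · exact absurd e.symm (hinj γ hγ β hlt)
  · exact heq
  · exact absurd e (hinj β hβ γ hlt)

end InnerModel

/-! ### Regularity as a first-order property, and functions as sets of pairs. -/

namespace SetFml

/-- `v i` is single-valued, as a set of ordered pairs. -/
def functional (i : ℕ) : SetFml :=
  .all (.all (.all (.imp (.app 2 1 (i + 3)) (.imp (.app 2 0 (i + 3)) (.eq 1 0)))))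

/-- Single-valued relations from a member of `v 0` to `v 0` are bounded. -/
def regular : SetFml :=
  .all (.imp (.mem 0 1) (.all (.imp (functional 0) (.ex (.and (.mem 0 3)
    (.all (.all (.imp (.mem 1 4) (.imp (.mem 0 5) (.imp (.app 1 0 3) (.mem 0 2)))))))))))

end SetFml

namespace InnerModel

section

variable {N : InnerModel.{u}}

/-- `r` is single-valued, as a set of ordered pairs. -/
def Functional (r : N) : Prop :=
  ∀ x y z : N, pr x y ∈ₘ r → pr x z ∈ₘ r → y = z

@[simp] theorem sat_functional (i : ℕ) (v : ℕ → N) :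
    (SetFml.functional i).sat v ↔ Functional (v i) := by
  simp [SetFml.functional, Functional]

theorem sat_regular (v : ℕ → N) : SetFml.regular.sat v ↔
    ∀ a : N, a ∈ₘ v 0 → ∀ r : N, Functional r → ∃ b : N, b ∈ₘ v 0 ∧
      ∀ x y : N, x ∈ₘ a → y ∈ₘ v 0 → pr x y ∈ₘ r → y ∈ₘ b := by
  simp [SetFml.regular]

theorem exists_converse (r : N) : ∃ s : N, ∀ x y : N, pr x y ∈ₘ s ↔ pr y x ∈ₘ r := by
  let φ : SetFml := .ex (.ex (.and (.pair 3 1 0) (.pair 2 0 1)))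
  have hφ : ∀ (v : ℕ → N) (q p : N), φ.sat (q ;; p ;; v) ↔
      ∃ x y : N, p = pr x y ∧ q = pr y x := by
    intro v q p
    simp [φ]
  obtain ⟨s, hs⟩ := N.zfc.repl φ (fun _ => r) r (by
    intro p _ q q' h h'
    rw [hφ] at h h'
    obtain ⟨x, y, rfl, rfl⟩ := h
    obtain ⟨x', y', e, rfl⟩ := h'
    obtain ⟨rfl, rfl⟩ := pr_inj.1 e
    rfl)
  refine ⟨s, fun x y => ?_⟩
  rw [hs]
  simp only [hφ]
  constructor
  · rintro ⟨p, hp, x', y', rfl, e⟩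
    obtain ⟨rfl, rfl⟩ := pr_inj.1 e
    exact hp
  · intro h
    exact ⟨_, h, _, _, rfl, rfl⟩

theorem exists_comp {r g : N} (hr : Functional r) (hg : Functional g) :
    ∃ s : N, Functional s ∧ ∀ x z : N, pr x z ∈ₘ s ↔ ∃ y, pr x y ∈ₘ r ∧ pr y z ∈ₘ g := by
  let φ : SetFml := .ex (.ex (.ex (.and (.pair 4 2 1) (.and (.pair 3 2 0) (.app 1 0 5)))))
  have hφ : ∀ q p : N, φ.sat (q ;; p ;; fun _ => g) ↔
      ∃ x y z : N, p = pr x y ∧ q = pr x z ∧ pr y z ∈ₘ g := by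
    intro q p
    simp [φ]
  obtain ⟨s, hs⟩ := N.zfc.repl φ (fun _ => g) r (by
    intro p _ q q' h h'
    rw [hφ] at h h'
    obtain ⟨x, y, z, rfl, rfl, hz⟩ := h
    obtain ⟨x', y', z', e, rfl, hz'⟩ := h'
    obtain ⟨rfl, rfl⟩ := pr_inj.1 e
    rw [hg _ _ _ hz hz'])
  have hs' : ∀ x z : N, pr x z ∈ₘ s ↔ ∃ y, pr x y ∈ₘ r ∧ pr y z ∈ₘ g := by
    intro x z
    rw [hs]
    simp only [hφ]
    constructor
    · rintro ⟨p, hp, x', y, z', rfl, e, hz⟩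
      obtain ⟨rfl, rfl⟩ := pr_inj.1 e
      exact ⟨y, hp, hz⟩
    · rintro ⟨y, hy, hz⟩
      exact ⟨_, hy, _, _, _, rfl, rfl, hz⟩
  refine ⟨s, fun x z z' h h' => ?_, hs'⟩
  obtain ⟨y, hy, hz⟩ := (hs' _ _).1 h
  obtain ⟨y', hy', hz'⟩ := (hs' _ _).1 h'
  obtain rfl := hr _ _ _ hy hy'
  exact hg _ _ _ hz hz'

/-- For a regular `δ`, the partial functions from smaller ordinals to `δ` are bounded too. -/
theorem IsRegular.sat {δ : Ordinal.{u}} (hδ : N.IsRegular δ) :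
    SetFml.regular.sat (fun _ => N.ord δ) := by
  rw [sat_regular]
  intro a ha r hr
  obtain ⟨α, hα, rfl⟩ := mem_ord.1 ha
  have hδ0 : 0 < δ := Ordinal.omega0_pos.trans_le hδ.1
  -- `IsRegular` concerns total functions: `r` is completed by `0` wherever it has no value in `δ`.
  let φ : SetFml := .ex (.and (.pair 1 2 0) (.or (.and (.mem 0 4) (.app 2 0 3))
    (.and (.neg (.ex (.and (.mem 0 5) (.app 3 0 4)))) (.eq 0 5))))
  have hφ : ∀ q x : N, φ.sat (q ;; x ;; r ;; N.ord δ ;; fun _ => N.ord 0) ↔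
      ∃ y : N, q = pr x y ∧ ((y ∈ₘ N.ord δ ∧ pr x y ∈ₘ r) ∨
        ((¬ ∃ y' : N, y' ∈ₘ N.ord δ ∧ pr x y' ∈ₘ r) ∧ y = N.ord 0)) := by
    intro q x
    simp [φ]
  have hu : ∀ x y z : N, ((y ∈ₘ N.ord δ ∧ pr x y ∈ₘ r) ∨
        ((¬ ∃ y' : N, y' ∈ₘ N.ord δ ∧ pr x y' ∈ₘ r) ∧ y = N.ord 0)) →
      ((z ∈ₘ N.ord δ ∧ pr x z ∈ₘ r) ∨
        ((¬ ∃ y' : N, y' ∈ₘ N.ord δ ∧ pr x y' ∈ₘ r) ∧ z = N.ord 0)) → y = z := by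
    rintro x y z (h | h) (h' | h')
    · exact hr _ _ _ h.2 h'.2
    · exact absurd ⟨y, h⟩ h'.1
    · exact absurd ⟨z, h'⟩ h.1
    · exact h.2.trans h'.2.symm
  obtain ⟨f, hf⟩ := N.zfc.repl φ (r ;; N.ord δ ;; fun _ => N.ord 0) (N.ord α) (by
    intro x _ q q' h h'
    rw [hφ] at h h'
    obtain ⟨y, rfl, hy⟩ := h
    obtain ⟨z, rfl, hz⟩ := h'
    rw [hu x y z hy hz])
  simp only [hφ] at hf
  have hf' : ∀ x y : N, x ∈ₘ N.ord α → (pr x y ∈ₘ f ↔ ((y ∈ₘ N.ord δ ∧ pr x y ∈ₘ r) ∨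
        ((¬ ∃ y' : N, y' ∈ₘ N.ord δ ∧ pr x y' ∈ₘ r) ∧ y = N.ord 0))) := by
    intro x y hx
    rw [hf]
    constructor
    · rintro ⟨x', -, y', e, h⟩
      obtain ⟨rfl, rfl⟩ := pr_inj.1 e
      exact h
    · intro h
      exact ⟨x, hx, y, rfl, h⟩
  have hfunc : ZFSet.IsFunc α.toZFSet δ.toZFSet (f : ZFSet.{u}) := by
    constructor
    · intro q hq
      obtain ⟨x, hx, y, e, h⟩ := (hf (sub f hq)).1 hq
      have e' : q = ZFSet.pair x y := congrArg Subtype.val e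
      rw [e', ZFSet.pair_mem_prod]
      refine ⟨hx, ?_⟩
      rcases h with h | ⟨-, rfl⟩
      · exact h.1
      · exact ord_mem_ord.2 hδ0
    · intro z hz
      let x : N := sub (N.ord α) hz
      have key : ∃ y : N, pr x y ∈ₘ f := by
        by_cases h : ∃ y' : N, y' ∈ₘ N.ord δ ∧ pr x y' ∈ₘ r
        · obtain ⟨y, hy⟩ := h
          exact ⟨y, (hf' x y hz).2 (Or.inl hy)⟩
        · exact ⟨N.ord 0, (hf' x _ hz).2 (Or.inr ⟨h, rfl⟩)⟩
      obtain ⟨y, hy⟩ := key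
      refine ⟨y, hy, fun w hw => ?_⟩
      obtain ⟨x', hx', y', e, h⟩ := (hf (sub f hw)).1 hw
      obtain ⟨e1, rfl⟩ := ZFSet.pair_inj.1 (congrArg Subtype.val e : ZFSet.pair z w = _)
      obtain rfl : x = x' := Subtype.ext e1
      exact congrArg Subtype.val (hu x _ _ h ((hf' x y hz).1 hy))
  obtain ⟨β, hβ, hb⟩ := hδ.2 α hα f hfunc
  refine ⟨N.ord β, ord_mem_ord.2 hβ, fun x y hx hy hxy => ?_⟩
  exact hb x y ((hf' x y hx).2 (Or.inl ⟨hy, hxy⟩))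

/-- A cofinal function `f` from `α` to `δ` gives a function `g` from `δ` to `α` with
`x ≤ f (g x)`. -/
theorem exists_functional_of_unbounded {α δ : Ordinal.{u}} {f : N}
    (hf : ZFSet.IsFunc α.toZFSet δ.toZFSet f)
    (hu : ∀ β < δ, ∃ x y : ZFSet.{u}, ZFSet.pair x y ∈ (f : ZFSet.{u}) ∧ y ∉ β.toZFSet) :
    ∃ (g : N) (h : Ordinal.{u} → Ordinal.{u}), Functional g ∧ (∀ i < α, h i < δ) ∧
      ∀ x < δ, ∃ i < α, pr (N.ord x) (N.ord i) ∈ₘ g ∧ x ≤ h i := by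
  have hval : ∀ i y : N, pr i y ∈ₘ f → i ∈ₘ N.ord α ∧ y ∈ₘ N.ord δ := by
    intro i y h
    exact ZFSet.pair_mem_prod.1 (hf.1 h)
  -- `g x` is the least `i` with `f i ≥ x`, written as `f i ∉ x`.
  let φ : SetFml := .ex (.and (.pair 1 2 0) (.and
    (.ex (.and (.app 1 0 4) (.neg (.mem 0 3))))
    (.all (.imp (.mem 0 1) (.all (.imp (.app 1 0 5) (.mem 0 4)))))))
  have hφ : ∀ q x : N, φ.sat (q ;; x ;; fun _ => f) ↔ ∃ i : N, q = pr x i ∧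
      (∃ y : N, pr i y ∈ₘ f ∧ ¬ y ∈ₘ x) ∧
      ∀ i' : N, i' ∈ₘ i → ∀ y : N, pr i' y ∈ₘ f → y ∈ₘ x := by
    intro q x
    simp [φ]
  have hun : ∀ x i i' : N, ((∃ y : N, pr i y ∈ₘ f ∧ ¬ y ∈ₘ x) ∧
      ∀ i' : N, i' ∈ₘ i → ∀ y : N, pr i' y ∈ₘ f → y ∈ₘ x) →
      ((∃ y : N, pr i' y ∈ₘ f ∧ ¬ y ∈ₘ x) ∧
      ∀ i : N, i ∈ₘ i' → ∀ y : N, pr i y ∈ₘ f → y ∈ₘ x) → i = i' := by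
    rintro x i i' ⟨⟨y, hy, hyx⟩, h⟩ ⟨⟨y', hy', hyx'⟩, h'⟩
    obtain ⟨γ, -, rfl⟩ := mem_ord.1 (hval _ _ hy).1
    obtain ⟨γ', -, rfl⟩ := mem_ord.1 (hval _ _ hy').1
    rcases lt_trichotomy γ γ' with hlt | heq | hlt
    · exact absurd (h' _ (ord_mem_ord.2 hlt) _ hy) hyx
    · rw [heq]
    · exact absurd (h _ (ord_mem_ord.2 hlt) _ hy') hyx'
  obtain ⟨g, hg⟩ := N.zfc.repl φ (fun _ => f) (N.ord δ) (by
    intro x _ q q' h h'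
    rw [hφ] at h h'
    obtain ⟨i, rfl, hi⟩ := h
    obtain ⟨i', rfl, hi'⟩ := h'
    rw [hun x i i' hi hi'])
  simp only [hφ] at hg
  have hh : ∀ i, ∃ η : Ordinal.{u}, i < α → pr (N.ord i) (N.ord η) ∈ₘ f := by
    intro i
    by_cases hi : i < α
    · obtain ⟨w, hw, -⟩ := hf.2 _ (ord_mem_ord (N := N).2 hi)
      have hw' := (ZFSet.pair_mem_prod.1 (hf.1 hw)).2
      obtain ⟨η, -, rfl⟩ := Ordinal.mem_toZFSet_iff.1 hw'
      exact ⟨η, fun _ => hw⟩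
    · exact ⟨0, fun h => absurd h hi⟩
  choose h hh using hh
  refine ⟨g, h, ?_, fun i hi => ord_mem_ord.1 (hval _ _ (hh i hi)).2, fun x hx => ?_⟩
  · intro x i i' h h'
    obtain ⟨x₁, -, i₁, e, h⟩ := (hg _).1 h
    obtain ⟨rfl, rfl⟩ := pr_inj.1 e
    obtain ⟨x₁, -, i₁, e, h'⟩ := (hg _).1 h'
    obtain ⟨rfl, rfl⟩ := pr_inj.1 e
    exact hun _ _ _ h h'
  · let T : Set Ordinal.{u} := {i | i < α ∧ ¬ h i < x}
    have hT : T.Nonempty := by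
      obtain ⟨a, y, hay, hy⟩ := hu x hx
      obtain ⟨ha, -⟩ := ZFSet.pair_mem_prod.1 (hf.1 hay)
      obtain ⟨i, hi, rfl⟩ := Ordinal.mem_toZFSet_iff.1 ha
      refine ⟨i, hi, fun hlt => hy ?_⟩
      obtain ⟨w, -, hw⟩ := hf.2 _ (ord_mem_ord (N := N).2 hi)
      rw [hw y hay, ← hw _ (hh i hi)]
      exact ord_mem_ord (N := N).2 hlt
    obtain ⟨hi, hix⟩ := csInf_mem hT
    refine ⟨sInf T, hi, (hg _).2 ⟨N.ord x, ord_mem_ord.2 hx, _, rfl,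
      ⟨_, hh _ hi, fun hm => hix (ord_mem_ord.1 hm)⟩, fun i' hi' y hy => ?_⟩, not_lt.1 hix⟩
    obtain ⟨γ, hγ, rfl⟩ := mem_ord.1 hi'
    have hlt : h γ < x := by
      by_contra hcon
      exact notMem_of_lt_csInf' hγ ⟨hγ.trans hi, hcon⟩
    obtain ⟨w, -, hw⟩ := hf.2 _ (ord_mem_ord (N := N).2 (hγ.trans hi))
    have e : y = N.ord (h γ) :=
      Subtype.ext ((hw y hy).trans (hw _ (hh γ (hγ.trans hi))).symm)
    rw [e]
    exact ord_mem_ord.2 hlt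

end

/-! ### Counting the ordinals whose images are values of a function in `M`. -/

section embedding

variable {N M : InnerModel.{u}} (j : N ↪ₑ[setLang] M)

theorem map_mem {x y : N} : j x ∈ₘ j y ↔ x ∈ₘ y := by
  have := SetFml.sat_map j (.mem 0 1) (x ;; fun _ => y)
  simpa [comp_scons] using this

theorem map_pr (x y : N) : j (pr x y) = pr (j x) (j y) := by
  have := SetFml.sat_map j (.pair 0 1 2) (pr x y ;; x ;; fun _ => y)
  simpa [comp_scons] using this

theorem map_functional {r : N} : Functional (j r) ↔ Functional r := by
  have := SetFml.sat_map j (.functional 0) (fun _ => r)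
  simpa using this

/-- The image of an ordinal is a transitive set. -/
theorem map_ord_trans (α : Ordinal.{u}) {x y : M} (hx : x ∈ₘ j (N.ord α)) (hy : y ∈ₘ x) :
    y ∈ₘ j (N.ord α) := by
  have := SetFml.sat_map j (.all (.all (.imp (.mem 1 2) (.imp (.mem 0 1) (.mem 0 2)))))
    (fun _ => N.ord α)
  simp only [SetFml.sat, scons_zero, scons_succ, Function.comp_apply] at this
  refine this.2 ?_ x y hx hy
  intro x y hx hy
  obtain ⟨β, hβ, rfl⟩ := mem_ord.1 hx
  obtain ⟨γ, hγ, rfl⟩ := mem_ord.1 hy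
  exact ord_mem_ord.2 (hγ.trans hβ)

/-- Zero and successor are definable, hence preserved. -/
theorem map_ord_nat (n : ℕ) : j (N.ord n) = M.ord n := by
  induction n with
  | zero =>
    have := SetFml.sat_map j (.neg (.ex (.mem 0 1))) (fun _ => N.ord 0)
    simp only [SetFml.sat, scons_zero, scons_succ, Function.comp_apply] at this
    refine ext fun z => iff_of_false (fun h => this.2 ?_ ⟨z, by simpa using h⟩) ?_
    · rintro ⟨x, hx⟩
      obtain ⟨β, hβ, -⟩ := mem_ord.1 hx
      exact not_lt_bot hβ
    · intro h
      obtain ⟨β, hβ, -⟩ := mem_ord.1 h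
      simp at hβ
  | succ n ih =>
    have key : ∀ (K : InnerModel.{u}) (z : K), z ∈ₘ K.ord (n + 1 : ℕ) ↔
        z ∈ₘ K.ord n ∨ z = K.ord n := by
      intro K z
      rw [mem_iff, Subtype.ext_iff]
      simp only [ord, Nat.cast_add, Nat.cast_one, Ordinal.toZFSet_add_one, ZFSet.mem_insert_iff]
      exact or_comm
    have := SetFml.sat_map j (.all (.iff (.mem 0 1) (.or (.mem 0 2) (.eq 0 2))))
      (N.ord (n + 1 : ℕ) ;; fun _ => N.ord n)
    simp only [SetFml.sat, scons_zero, scons_succ, Function.comp_apply] at this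
    exact ext fun z => (this.2 (key N) z).trans (by rw [key M, ih])

theorem IsCriticalPoint.omega0_le {j : N ↪ₑ[setLang] M} {κ : Ordinal.{u}}
    (hκ : IsCriticalPoint j κ) : Ordinal.omega0 ≤ κ := by
  by_contra! h
  obtain ⟨n, rfl⟩ := Ordinal.lt_omega0.1 h
  exact hκ.1 (map_ord_nat j n)

/-- The ordinals below `δ` whose image under `j` is a value of `r` at a member of `j lam`. -/
def valueOrds (lam : Ordinal.{u}) (r : M) (δ : Ordinal.{u}) : Set Ordinal.{u} :=
  {x | x < δ ∧ ∃ ξ : M, ξ ∈ₘ j (N.ord lam) ∧ pr ξ (j (N.ord x)) ∈ₘ r}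

variable {j}

/-- By elementarity `j(δ)` is regular in `M`, and `j(λ) < j(δ)`; so the values of `r` below `j(δ)`
have a bound `b` in `j(δ)`, which continuity places below some `j(α)`. -/
theorem valueOrds_subset_of_isRegular {lam δ : Ordinal.{u}} (hlam : lam < δ)
    (hδ : N.IsRegular δ) (hcont : IsContinuousAt j δ) {r : M} (hr : Functional r) :
    ∃ α < δ, valueOrds j lam r δ ⊆ valueOrds j lam r α := by
  have h := (SetFml.sat_map j _ _).2 hδ.sat
  rw [sat_regular] at h
  obtain ⟨b, hb, h⟩ := h _ ((map_mem j).2 (ord_mem_ord.2 hlam)) r hr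
  have hb' : (b : ZFSet.{u}) ∈ (j (N.ord δ) : ZFSet.{u}) := hb
  rw [hcont, ZFSet.mem_iUnion] at hb'
  obtain ⟨⟨α, hα⟩, hbα⟩ := hb'
  refine ⟨α, hα, ?_⟩
  rintro x ⟨hx, ξ, hξ, hxr⟩
  refine ⟨?_, ξ, hξ, hxr⟩
  have hxb := h _ _ hξ ((map_mem j).2 (ord_mem_ord.2 hx)) hxr
  exact ord_mem_ord.1 ((map_mem j).1 (map_ord_trans j α hbα hxb))

/-- The induction on `δ` keeps `r` arbitrary, because the singular case also uses the hypothesis for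
`s = j(g) ∘ r`. -/
theorem mk_valueOrds_le {lam : Ordinal.{u}} (hω : Ordinal.omega0 ≤ lam)
    (hcont : ∀ δ : Ordinal.{u}, (Order.succ lam.card).ord ≤ δ → N.IsRegular δ →
      IsContinuousAt j δ) (δ : Ordinal.{u}) :
    ∀ r : M, Functional r →
      Cardinal.mk (valueOrds j lam r δ) ≤ Cardinal.lift.{u + 1} lam.card := by
  have hinf : Cardinal.aleph0 ≤ Cardinal.lift.{u + 1} lam.card := by
    rw [Cardinal.aleph0_le_lift]
    simpa using Ordinal.card_le_card hω
  induction δ using WellFoundedLT.induction with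
  | _ δ ih =>
    intro r hr
    rcases lt_or_ge δ (Order.succ lam.card).ord with hδ | hδ
    · have h1 : δ.card ≤ lam.card := by
        rw [Cardinal.lt_ord] at hδ
        exact Order.lt_succ_iff.1 hδ
      refine (Cardinal.mk_le_mk_of_subset (t := Set.Iio δ) fun x hx => hx.1).trans ?_
      rw [Cardinal.mk_Iio_ordinal]
      exact Cardinal.lift_le.2 h1
    · have hlam : lam < δ := by
        refine lt_of_lt_of_le ?_ hδ
        rw [Cardinal.lt_ord]
        exact Order.lt_succ _
      by_cases hreg : N.IsRegular δ
      · obtain ⟨α, hα, hsub⟩ :=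
          valueOrds_subset_of_isRegular hlam hreg (hcont δ hδ hreg) hr
        exact (Cardinal.mk_le_mk_of_subset hsub).trans (ih α hα r hr)
      · have hex : ∃ α < δ, ∃ f : N, ZFSet.IsFunc α.toZFSet δ.toZFSet f ∧ ∀ β < δ,
            ∃ x y : ZFSet.{u}, ZFSet.pair x y ∈ (f : ZFSet.{u}) ∧ y ∉ β.toZFSet := by
          by_contra! hcon
          exact hreg ⟨hω.trans hlam.le, hcon⟩
        obtain ⟨α, hα, f, hf, hu⟩ := hex
        obtain ⟨g, h, hg, hh, hgh⟩ := exists_functional_of_unbounded hf hu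
        obtain ⟨s, hs, hs'⟩ := exists_comp hr ((map_functional j).2 hg)
        -- If `r ξ = j(x)` and `i = g x`, then `s ξ = j(i)` and `x ≤ h i`. The `insert` covers `x =
        -- h i`, which cannot be avoided when `δ` is a successor.
        have hsub : valueOrds j lam r δ ⊆
            ⋃ i : valueOrds j lam s α, insert (h i) (valueOrds j lam r (h i)) := by
          rintro x ⟨hx, ξ, hξ, hxr⟩
          obtain ⟨i, hi, hgi, hxi⟩ := hgh x hx
          refine Set.mem_iUnion.2 ⟨⟨i, hi, ξ, hξ, (hs' _ _).2 ⟨_, hxr, ?_⟩⟩, ?_⟩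
          · rw [← map_pr, map_mem]
            exact hgi
          · rcases hxi.eq_or_lt with e | hlt
            · exact Or.inl e
            · exact Or.inr ⟨hlt, ξ, hξ, hxr⟩
        refine (Cardinal.mk_le_mk_of_subset hsub).trans ((Cardinal.mk_iUnion_le _).trans ?_)
        refine (mul_le_mul' (ih α hα s hs) (ciSup_le' fun i => ?_)).trans
          (Cardinal.mul_eq_self hinf).le
        refine Cardinal.mk_insert_le.trans ?_
        exact Cardinal.add_le_of_le hinf (ih _ (hh i i.2.1) r hr)
          (Cardinal.one_le_aleph0.trans hinf)

end embedding

end InnerModel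

/-! ### From arbitrary sets to ordinals. -/

/-- Here `lam` is any ordinal that is at least `κ` (in particular, it may be a cardinal of `V` or
of `N`), and `(Order.succ lam.card).ord` is its cardinal successor in `V`. -/
theorem mainTheorem6 (N M : InnerModel.{u}) (j : N ↪ₑ[setLang] M) (κ lam : Ordinal.{u})
    (hκ : InnerModel.IsCriticalPoint j κ) (hlam : κ ≤ lam)
    (hcont : ∀ δ : Ordinal.{u}, (Order.succ lam.card).ord ≤ δ → N.IsRegular δ →
      InnerModel.IsContinuousAt j δ)
    (A : M) (hA : M.CardLE A (j (N.ord lam))) :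
    (ZFSet.sep (fun x => x ∈ InnerModel.ran j) (A : ZFSet.{u})).card ≤ lam.card := by
  open InnerModel in
  obtain ⟨f, hf, hinj⟩ := hA
  let R : ZFSet.{u} := ZFSet.sep (fun x => x ∈ ran j) (A : ZFSet.{u})
  have hR : ∀ y : R, ∃ x : N, (j x : ZFSet.{u}) = y := fun y => (ZFSet.mem_sep.1 y.2).2
  choose x hx using hR
  have hxA : ∀ y : R, j (x y) ∈ₘ A := by
    intro y
    rw [mem_iff, hx]
    exact (ZFSet.mem_sep.1 y.2).1
  -- The preimages are chosen in `V` and need not form a set of `N`; a level of the hierarchy of `N`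
  -- contains them all.
  obtain ⟨B, hB⟩ := exists_rank_lt (N := N)
    (Order.succ (⨆ y : Shrink.{u} R, ((x ((equivShrink R).symm y) : N) : ZFSet.{u}).rank))
  have hxB : ∀ y : R, x y ∈ₘ B := by
    intro y
    rw [hB, Order.lt_succ_iff]
    have := Ordinal.le_iSup
      (fun y : Shrink.{u} R => ((x ((equivShrink R).symm y) : N) : ZFSet.{u}).rank)
      (equivShrink R y)
    simpa using this
  obtain ⟨α, F, e, he, hF, hFB⟩ := exists_enumeration B
  obtain ⟨f', hf'⟩ := exists_converse f
  obtain ⟨e', he'⟩ := exists_converse e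
  have hff : Functional f' := by
    intro ξ a b ha hb
    rw [hf'] at ha hb
    exact Subtype.ext (hinj _ _ _ ha hb)
  have hee : Functional e' := by
    intro z a b ha hb
    obtain ⟨β, hβ, e1⟩ := (he _).1 ((he' _ _).1 ha)
    obtain ⟨γ, hγ, e2⟩ := (he _).1 ((he' _ _).1 hb)
    obtain ⟨rfl, rfl⟩ := pr_inj.1 e1
    obtain ⟨rfl, e3⟩ := pr_inj.1 e2
    rw [hF β hβ γ hγ e3]
  -- `r = j(e⁻¹) ∘ f⁻¹` sends `f(j(F β))` to `j(β)`.
  obtain ⟨r, hr, hr'⟩ := exists_comp hff ((map_functional j).2 hee)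
  have hind : ∀ y : R, ∃ β : valueOrds j lam r α, x y = F β := by
    intro y
    obtain ⟨β, hβ, hy⟩ := hFB _ (hxB y)
    obtain ⟨w, hw, -⟩ := hf.2 _ (hxA y)
    have hw' := (ZFSet.pair_mem_prod.1 (hf.1 hw)).2
    refine ⟨⟨β, hβ, sub _ hw', hw', (hr' _ _).2 ⟨j (x y), (hf' _ _).2 hw, ?_⟩⟩, hy⟩
    rw [← map_pr, map_mem, he', he]
    exact ⟨β, hβ, by rw [hy]⟩
  choose b hb using hind
  have hbinj : Function.Injective b := by
    intro y z h
    refine Subtype.ext ?_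
    rw [← hx, ← hx, hb y, hb z, h]
  rw [← Cardinal.lift_le.{u + 1}, ← ZFSet.cardinalMk_coe_sort]
  exact (Cardinal.mk_le_of_injective hbinj).trans
    (mk_valueOrds_le (hκ.omega0_le.trans hlam) hcont α r hr)
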